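/- Consider an unobservable queueing game with actions $a_1,\dots,a_k$, $k\ge 2$. Potential customers arrive according to a renewal process with arrival epochs $T_1\le T_2\le\cdots$, and a strategy is a probability vector $\mathbf p$ in the unit simplex $\Delta\subset\mathbb R^k$. When all customers play $\mathbf p$, the system state $X(t;\mathbf p)$ is a right-continuous process with left-hand limits and values in a set $\mathcal X\subset\mathbb R^d_+$. The first customer finds an empty system, $X(T_1-;\mathbf p)=0$. It is assumed that, for every $\mathbf p\in\Delta$, the state $X(T_n-;\mathbf p)$ just before the $n$-th arrival converges in distribution, as $n\to\infty$, to a stationary state $X(\mathbf p)\in\mathcal X$. Let $\mathbf v(x,y)\in\mathbb R^k$ be the vector of the values of the $k$ actions at state $x$ and random outcome $y$ (the function $\mathbf v$ and the random outcome $Y$ may depend on $\mathbf p$, and $Y$ may depend on the state). Assume that $\mathbf v(X(\mathbf p),Y)$ is integrable for every $\mathbf p\in\Delta$, and put $$\mathbf u(\mathbf p)=\mathrm E_{\mathbf p}\big[\mathbf v(X(\mathbf p),Y)\big]\in\mathbb R^k .$$ A symmetric Nash equilibrium is a strategy $\mathbf p\in\Delta$ with $\mathbf p\in\operatorname{argmax}_{\mathbf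 q\in\Delta}\mathbf u(\mathbf p)'\mathbf q$. Let $\pi_\Delta(\mathbf x)=\operatorname{argmin}_{\mathbf y\in\Delta}\Vert\mathbf x-\mathbf y\Vert$ be the Euclidean projection onto $\Delta$ and let $\mathbf f(\mathbf p)=\pi_\Delta(\mathbf p+\mathbf u(\mathbf p))$ for $\mathbf p\in\Delta$. If $\mathbf u:\Delta\to\mathbb R^k$ is continuous, then a symmetric Nash equilibrium $\mathbf p^e\in\Delta$ exists, and every symmetric Nash equilibrium $\mathbf p^e$ satisfies $\mathbf p^e=\mathbf f(\mathbf p^e)$. -/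

import Mathlib

open MeasureTheory ProbabilityTheory Filter Topology
open scoped NNReal

namespace QueueingGame

/-! ### The simplex of strategies and the Euclidean projection -/

/-- The unit simplex `Δ` with `k` vertices, as a subset of Euclidean space `ℝᵏ`. -/
def simplex (k : ℕ) : Set (EuclideanSpace ℝ (Fin k)) :=
  {p | (fun i => p i) ∈ stdSimplex ℝ (Fin k)}

/-- A (mixed) strategy over `k` actions: a point of the simplex, `p i` being the probability of
the `i`-th action. -/
abbrev Strategy (k : ℕ) : Type := simplex k

/-- The projection of `x` onto `S` as a set: all points of `S` at minimal distance from `x`. -/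
def projSet {E : Type*} [NormedAddCommGroup E] (S : Set E) (x : E) : Set E :=
  {y | y ∈ S ∧ ∀ z ∈ S, ‖x - y‖ ≤ ‖x - z‖}

theorem convex_simplex (k : ℕ) : Convex ℝ (simplex k) := by
  intro x hx y hy a b ha hb hab
  exact convex_stdSimplex ℝ (Fin k) hx hy ha hb hab

theorem isCompact_simplex (k : ℕ) : IsCompact (simplex k) := by
  have h := (isCompact_stdSimplex ℝ (Fin k)).image
    (EuclideanSpace.equiv (Fin k) ℝ).symm.continuous
  convert h using 1
  ext p
  constructor
  · intro hp
    exact ⟨fun i => p i, hp, by ext i; rfl⟩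
  · rintro ⟨q, hq, rfl⟩
    exact hq

theorem simplex_nonempty {k : ℕ} (hk : 0 < k) : (simplex k).Nonempty :=
  ⟨WithLp.toLp 2 (Pi.single (⟨0, hk⟩ : Fin k) (1 : ℝ)), single_mem_stdSimplex ℝ (⟨0, hk⟩ : Fin k)⟩

/-- Every point has exactly one nearest point in the simplex. -/
theorem existsUnique_projSet_simplex {k : ℕ} (hk : 0 < k) (x : EuclideanSpace ℝ (Fin k)) :
    ∃! y : Strategy k, (y : EuclideanSpace ℝ (Fin k)) ∈ projSet (simplex k) x := by
  obtain ⟨y, hy, hmin⟩ := (isCompact_simplex k).exists_isMinOn (simplex_nonempty hk)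
    (f := fun z => ‖x - z‖) (by fun_prop)
  have hmin' : ∀ z ∈ simplex k, ‖x - y‖ ≤ ‖x - z‖ := fun z hz => hmin hz
  refine ⟨⟨y, hy⟩, ⟨hy, hmin'⟩, ?_⟩
  rintro ⟨z, hz⟩ ⟨-, hzmin⟩
  have hm : (1 / 2 : ℝ) • y + (1 / 2 : ℝ) • z ∈ simplex k :=
    convex_simplex k hy hz (by norm_num) (by norm_num) (by norm_num)
  have e : ‖x - y‖ = ‖x - z‖ := le_antisymm (hmin' z hz) (hzmin y hy)
  have h1 := hmin' _ hm
  have hp := parallelogram_law_with_norm ℝ (x - y) (x - z)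
  have e1 : x - y + (x - z) = (2 : ℝ) • (x - ((1 / 2 : ℝ) • y + (1 / 2 : ℝ) • z)) := by
    module
  have e2 : x - y - (x - z) = z - y := by abel
  rw [e1, e2, norm_smul, ← e] at hp
  have h0 : ‖z - y‖ = 0 := by
    have : ‖(2 : ℝ)‖ = 2 := by norm_num
    rw [this] at hp
    nlinarith [norm_nonneg (z - y), norm_nonneg (x - y),
      norm_nonneg (x - ((1 / 2 : ℝ) • y + (1 / 2 : ℝ) • z))]
  exact Subtype.ext (sub_eq_zero.mp (norm_eq_zero.mp h0))

/-- The projection `π_Δ(x)`, as a point of the simplex. -/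
noncomputable def projSimplex {k : ℕ} (hk : 0 < k) (x : EuclideanSpace ℝ (Fin k)) : Strategy k :=
  (existsUnique_projSet_simplex hk x).choose

/-- The set-valued projection onto the simplex is the singleton `{π_Δ(x)}`. -/
theorem projSet_simplex_eq {k : ℕ} (hk : 0 < k) (x : EuclideanSpace ℝ (Fin k)) :
    projSet (simplex k) x = {(projSimplex hk x : EuclideanSpace ℝ (Fin k))} := by
  have h := (existsUnique_projSet_simplex hk x).choose_spec
  ext y
  constructor
  · intro hy
    exact congrArg Subtype.val (h.2 ⟨y, hy.1⟩ hy)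
  · rintro rfl
    exact h.1

/-! ### Arrivals -/

/-- The `n`-th arrival epoch `T_n`, the sum of the first `n` inter-arrival times; `A i` is the time
between the `i`-th and the `(i+1)`-st arrival. -/
def arrivalTime {Ω : Type*} (A : ℕ → Ω → ℝ≥0) (n : ℕ) (ω : Ω) : ℝ≥0 :=
  ∑ i ∈ Finset.range n, A i ω

/-- The state `X(T_n-)` just before the `n`-th arrival. -/
noncomputable def stateAtArrival {Ω E : Type*} [TopologicalSpace E] (A : ℕ → Ω → ℝ≥0)
    (X : ℝ≥0 → Ω → E) (n : ℕ) (ω : Ω) : E :=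
  Function.leftLim (fun t => X t ω) (arrivalTime A n ω)

/-- Right-continuous with left-hand limits. -/
def IsCadlag {E : Type*} [TopologicalSpace E] (x : ℝ≥0 → E) : Prop :=
  ∀ t, ContinuousWithinAt x (Set.Ici t) t ∧ ∃ l, Tendsto x (𝓝[<] t) (𝓝 l)

/-! ### The game -/

/-- An unobservable queueing game with `k ≥ 2` actions and buffer content in `ℝᵈ₊`.
For each strategy `p` played by all customers, `P p` is the governing probability measure (with
expectation `E_p`) and `X p` the content process. How actions drive the content process is left
unspecified, so `p ↦ (P p, X p)` is arbitrary subject to the listed requirements. The value vector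
`v` and the random outcome `Y` may depend on `p`, and `Y` may depend on the state. -/
structure UnobservableQueueingGame (k d : ℕ) (Ω : Type*) [MeasurableSpace Ω]
    (𝒴 : Type*) [MeasurableSpace 𝒴] where
  two_le : 2 ≤ k
  /-- The state space. -/
  stateSpace : Set (EuclideanSpace ℝ (Fin d))
  stateSpace_nonneg : ∀ x ∈ stateSpace, ∀ i, 0 ≤ x i
  /-- The probability measure when all customers play `p`. -/
  P : Strategy k → Measure Ω
  [isProbabilityMeasure : ∀ p, IsProbabilityMeasure (P p)]
  /-- Inter-arrival times of the potential customers. -/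
  A : ℕ → Ω → ℝ≥0
  /-- The inter-arrival distribution, which is not concentrated at zero. -/
  arrivalLaw : Measure ℝ≥0
  arrivalLaw_ne : arrivalLaw ≠ Measure.dirac 0
  A_law : ∀ p n, HasLaw (A n) arrivalLaw (P p)
  A_indep : ∀ p, iIndepFun A (P p)
  /-- The content process under each strategy. -/
  X : Strategy k → ℝ≥0 → Ω → EuclideanSpace ℝ (Fin d)
  X_measurable : ∀ p t, Measurable (X p t)
  X_mem : ∀ p, ∀ᵐ ω ∂P p, ∀ t, X p t ω ∈ stateSpace
  X_cadlag : ∀ p, ∀ᵐ ω ∂P p, IsCadlag (fun t => X p t ω)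
  /-- The first customer finds an empty system. -/
  X_first : ∀ p, ∀ᵐ ω ∂P p, stateAtArrival A (X p) 1 ω = 0
  /-- A state with the stationary distribution at arrival epochs. -/
  Xstat : Strategy k → Ω → EuclideanSpace ℝ (Fin d)
  Xstat_mem : ∀ p, ∀ᵐ ω ∂P p, Xstat p ω ∈ stateSpace
  /-- The state found by the `n`-th customer converges in distribution to the stationary state. -/
  tendsto_stat : ∀ p, TendstoInDistribution (fun n => stateAtArrival A (X p) (n + 1)) atTop
    (Xstat p) (fun _ => P p) (P p)
  /-- The random outcome of a customer who arrives at the stationary system. -/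
  Y : Strategy k → Ω → 𝒴
  Y_measurable : ∀ p, AEMeasurable (Y p) (P p)
  /-- The vector of values `v(x, y)` of the `k` actions (when all other customers play `p`). -/
  v : Strategy k → EuclideanSpace ℝ (Fin d) → 𝒴 → EuclideanSpace ℝ (Fin k)
  v_integrable : ∀ p, Integrable (fun ω => v p (Xstat p ω) (Y p ω)) (P p)

namespace UnobservableQueueingGame

variable {k d : ℕ} {Ω : Type*} [MeasurableSpace Ω] {𝒴 : Type*} [MeasurableSpace 𝒴]

/-- The vector of expected stationary values, `u(p) = E_p[v(X(p), Y)]`. -/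
noncomputable def u (G : UnobservableQueueingGame k d Ω 𝒴) (p : Strategy k) :
    EuclideanSpace ℝ (Fin k) :=
  ∫ ω, G.v p (G.Xstat p ω) (G.Y p ω) ∂(G.P p)

/-- The best-response set: the maximizers over `q ∈ Δ` of `u(p)'q`. -/
def bestResponse (G : UnobservableQueueingGame k d Ω 𝒴) (p : Strategy k) : Set (Strategy k) :=
  {q | ∀ r : Strategy k, ∑ i, G.u p i * r.1 i ≤ ∑ i, G.u p i * q.1 i}

/-- A symmetric Nash equilibrium is a strategy that is a best response to itself. -/
def IsSymmetricNashEquilibrium (G : UnobservableQueueingGame k d Ω 𝒴) (p : Strategy k) : Prop :=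
  p ∈ G.bestResponse p

/-- The map `f(p) = π_Δ(p + u(p))` from the simplex to itself. -/
noncomputable def f (G : UnobservableQueueingGame k d Ω 𝒴) (p : Strategy k) : Strategy k :=
  projSimplex (lt_of_lt_of_le Nat.zero_lt_two G.two_le) (p.1 + G.u p)

end UnobservableQueueingGame

end QueueingGame

/-! An equilibrium exists by Nash's argument: the map that raises each `p i` by the positive part of
the excess of `u p i` over the average payoff, and renormalizes, has a fixed point by Brouwer, and
at a fixed point all excesses vanish. If `p` maximizes `⟪u p, ·⟫` over `Δ`, then expanding `‖u p +
(p - z)‖ ^ 2` gives at least `‖u p‖ ^ 2`, so `p` is the nearest point of `Δ` to `p + u p`.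

Brouwer is derived from Scarf's lemma (`exists_colourful_dominant`) instead of Sperner's. A parity
count of incidences between rooms (dominant sets of size `card I`) and doors (sets with one point
fewer, showing each colour except `i₀` once) produces a colourful room. Applied to a grid whose
points are coloured by a coordinate that `f` does not decrease, it gives small clusters; their limit
satisfies `p i ≤ f p i` for all `i`, and equal sums force `f p = p`. -/

namespace Scarf

open Finset Function

/-- A finite set `S` is dominant for the family of rankings `r` if no point ranks, for every index,
strictly above the minimum of `S`. -/
def IsDominant {I X L : Type*} [LinearOrder L] (r : I → X → L) (S : Finset X) : Prop :=
  ∀ y, ∃ i, ∀ x ∈ S, r i y ≤ r i x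

/-- `x` is ranked highest by `r i` among the points that lie above `m l` for all `l ≠ i`. -/
def IsTop {I X L : Type*} [LinearOrder L] (r : I → X → L) (m : I → X) (i : I) (x : X) : Prop :=
  (∀ l, l ≠ i → r l (m l) < r l x) ∧ ∀ y, (∀ l, l ≠ i → r l (m l) < r l y) → r i y ≤ r i x

/-! ### Dominant sets: extensions and colour parity. -/

section Abstract

variable {I X L : Type*} [LinearOrder L] {r : I → X → L} {D : Finset X} {m : I → X}

theorem IsDominant.mono {S : Finset X} (h : IsDominant r S) (hD : D ⊆ S) : IsDominant r D :=
  fun y => (h y).imp fun _ hi x hx => hi x (hD hx)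

theorem exists_isTop [Finite X] {i : I} {x₀ : X} (h : ∀ l, l ≠ i → r l (m l) < r l x₀) :
    ∃ x, IsTop r m i x := by
  obtain ⟨x, hx, hmax⟩ := Set.exists_max_image {x | ∀ l, l ≠ i → r l (m l) < r l x} (r i)
    (Set.toFinite _) ⟨x₀, h⟩
  exact ⟨x, hx, hmax⟩

theorem IsTop.unique (hr : ∀ i, Injective (r i)) {i : I} {x y : X} (hx : IsTop r m i x)
    (hy : IsTop r m i y) : x = y :=
  hr i (le_antisymm (hy.2 x hx.1) (hx.2 y hy.1))

/-- Dominance at `x` yields an index `l` at which `x` is not above `m l`, and being top leaves only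
`l = i`. Then `x ∈ D` forces `x = m i = m j`, yet `x` must lie above `m j`. -/
theorem IsTop.notMem (hr : ∀ i, Injective (r i)) (hD : IsDominant r D) (hmD : ∀ l, m l ∈ D)
    (hmin : ∀ l, ∀ x ∈ D, r l (m l) ≤ r l x) {i j : I} (hij : i ≠ j) (hm : m i = m j) {x : X}
    (hx : IsTop r m i x) : x ∉ D := by
  intro hxD
  obtain ⟨l, hl⟩ := hD x
  by_cases hli : l = i
  · subst hli
    have h1 : x = m l := hr l (le_antisymm (hl _ (hmD l)) (hmin l x hxD))
    exact absurd (hx.1 j hij.symm) (by rw [h1, hm]; exact lt_irrefl _)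
  · exact absurd (hl _ (hmD l)) (not_le.mpr (hx.1 l hli))

theorem IsTop.isDominant_insert [DecidableEq X] (hD : IsDominant r D) (hmD : ∀ l, m l ∈ D)
    (hmin : ∀ l, ∀ x ∈ D, r l (m l) ≤ r l x) {i : I} {x : X} (hx : IsTop r m i x) :
    IsDominant r (insert x D) := by
  intro y
  by_cases hy : ∀ l, l ≠ i → r l (m l) < r l y
  · obtain ⟨l, hl⟩ := hD y
    have hli : l = i := by
      by_contra hli
      exact absurd (hl _ (hmD l)) (not_le.mpr (hy l hli))
    subst hli
    refine ⟨l, fun z hz => ?_⟩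
    rcases mem_insert.mp hz with rfl | hz
    · exact hx.2 y hy
    · exact hl z hz
  · push Not at hy
    obtain ⟨l, hli, hl⟩ := hy
    refine ⟨l, fun z hz => ?_⟩
    rcases mem_insert.mp hz with rfl | hz
    · exact hl.trans (hx.1 l hli).le
    · exact hl.trans (hmin l z hz)

/-- Let `A` be the indices at which `x` lies above the minimum of `D`. Every point of `D` is still a
minimum at some index of `A`, while `A` omits the index `l₀` at which `x` is minimal. Counting gives
`A = univ.erase l₀` with `m` injective on it, so `i` or `j` is `l₀`. -/
theorem isTop_of_isDominant_insert [Fintype I] [DecidableEq I] [DecidableEq X]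
    (hr : ∀ i, Injective (r i))
    (hcard : #D + 1 = Fintype.card I) (hmD : ∀ l, m l ∈ D)
    (hmin : ∀ l, ∀ x ∈ D, r l (m l) ≤ r l x) {i j : I} (hij : i ≠ j) (hm : m i = m j)
    {x : X} (hx : x ∉ D) (hdom : IsDominant r (insert x D)) :
    IsTop r m i x ∨ IsTop r m j x := by
  obtain ⟨l₀, hl₀⟩ := hdom x
  set A : Finset I := univ.filter fun l => r l (m l) < r l x with hA
  have hsurj : D ⊆ A.image m := by
    intro d hd
    obtain ⟨l, hl⟩ := hdom d
    have h1 : d = m l := hr l (le_antisymm (hl _ (mem_insert_of_mem (hmD l))) (hmin l d hd))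
    have h2 : r l d ≠ r l x := fun h => hx (hr l h ▸ hd)
    refine mem_image.mpr ⟨l, ?_, h1.symm⟩
    simp only [hA, mem_filter, mem_univ, true_and]
    rw [← h1]
    exact lt_of_le_of_ne (hl _ (mem_insert_self _ _)) h2
  have hl₀A : A ⊆ univ.erase l₀ := by
    intro l hl
    refine mem_erase.mpr ⟨?_, mem_univ _⟩
    rintro rfl
    exact absurd (hl₀ _ (mem_insert_of_mem (hmD l))) (not_le.mpr (mem_filter.mp hl).2)
  have hc1 : #(univ.erase l₀) = #D := by
    rw [card_erase_of_mem (mem_univ _), card_univ]; omega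
  have hc2 : #D ≤ #(A.image m) := card_le_card hsurj
  have hc3 : #(A.image m) ≤ #A := card_image_le
  have hAeq : A = univ.erase l₀ := eq_of_subset_of_card_le hl₀A (by omega)
  have hinj : Set.InjOn m A := card_image_iff.mp (by
    have := card_le_card hl₀A
    omega)
  have hM : ∀ l, l ≠ l₀ → r l (m l) < r l x := fun l hl => by
    have : l ∈ A := hAeq ▸ mem_erase.mpr ⟨hl, mem_univ _⟩
    exact (mem_filter.mp this).2
  have htop : IsTop r m l₀ x := by
    refine ⟨hM, fun y hy => ?_⟩
    obtain ⟨l, hl⟩ := hdom y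
    by_cases h : l = l₀
    · exact h ▸ hl x (mem_insert_self _ _)
    · exact absurd (hl _ (mem_insert_of_mem (hmD l))) (not_le.mpr (hy l h))
  by_cases hi : i = l₀
  · exact Or.inl (hi ▸ htop)
  by_cases hj : j = l₀
  · exact Or.inr (hj ▸ htop)
  exact absurd (hinj (hAeq ▸ mem_erase.mpr ⟨hi, mem_univ _⟩ : i ∈ A)
    (hAeq ▸ mem_erase.mpr ⟨hj, mem_univ _⟩ : j ∈ A) hm) hij

open Classical in
/-- A dominant set with one element less than there are indices extends to exactly two dominant
sets with one more element, provided that every index leaves room for an extension. -/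
theorem card_dominant_supersets [Fintype I] [Fintype X]
    (hr : ∀ i, Injective (r i)) (hD : IsDominant r D) (hcard : #D + 1 = Fintype.card I)
    (hmD : ∀ l, m l ∈ D) (hmin : ∀ l, ∀ x ∈ D, r l (m l) ≤ r l x)
    (hne : ∀ i, ∃ x, ∀ l, l ≠ i → r l (m l) < r l x) :
    #{R : Finset X | (#R = Fintype.card I ∧ IsDominant r R) ∧ D ⊆ R} = 2 := by
  -- By pigeonhole two indices share their minimum; the two extensions add the top point of one or
  -- of the other.
  obtain ⟨i, -, j, -, hij, hm⟩ := exists_ne_map_eq_of_card_lt_of_maps_to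
    (s := (univ : Finset I)) (t := D) (f := m) (by rw [card_univ]; omega) (fun l _ => hmD l)
  obtain ⟨x, hx⟩ := exists_isTop (hne i).choose_spec
  obtain ⟨y, hy⟩ := exists_isTop (hne j).choose_spec
  have hxD := hx.notMem hr hD hmD hmin hij hm
  have hyD := hy.notMem hr hD hmD hmin hij.symm hm.symm
  have hxy : x ≠ y := by
    rintro rfl
    obtain ⟨l, hl⟩ := hD x
    refine absurd (hl _ (hmD l)) (not_le.mpr ?_)
    by_cases hli : l = i
    · exact hy.1 l (hli ▸ hij)
    · exact hx.1 l hli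
  rw [card_eq_two]
  refine ⟨insert x D, insert y D, fun h => ?_, ?_⟩
  · have : x ∈ insert y D := h ▸ mem_insert_self x D
    rcases mem_insert.mp this with h | h
    · exact hxy h
    · exact hxD h
  · ext R
    simp only [mem_filter, mem_univ, true_and, mem_insert, mem_singleton]
    constructor
    · rintro ⟨⟨hR, hdom⟩, hDR⟩
      obtain ⟨z, hz, rfl⟩ := exists_eq_insert_iff.mpr ⟨hDR, hcard.trans hR.symm⟩
      rcases isTop_of_isDominant_insert hr hcard hmD hmin hij hm hz hdom with h | h
      · exact Or.inl (by rw [h.unique hr hx])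
      · exact Or.inr (by rw [h.unique hr hy])
    · rintro (rfl | rfl)
      · exact ⟨⟨(card_insert_of_notMem hxD).trans hcard, hx.isDominant_insert hD hmD hmin⟩,
          subset_insert _ _⟩
      · exact ⟨⟨(card_insert_of_notMem hyD).trans hcard, hy.isDominant_insert hD hmD hmin⟩,
          subset_insert _ _⟩

open Classical in
/-- In a set that misses a colour, the number of subsets with exactly the colours other than `i₀`,
each occurring once, is even. -/
theorem even_card_subsets_of_not_colourful [Fintype I] [Fintype X] (c : X → I) (i₀ : I)
    {R : Finset X} (hR : #R = Fintype.card I) (hc : R.image c ≠ univ) :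
    Even #{D : Finset X | (#D + 1 = Fintype.card I ∧ D.image c = univ.erase i₀) ∧ D ⊆ R} := by
  rcases eq_empty_or_nonempty
    {D : Finset X | (#D + 1 = Fintype.card I ∧ D.image c = univ.erase i₀) ∧ D ⊆ R}
    with h | ⟨D, hD⟩
  · rw [h]; simp
  simp only [mem_filter, mem_univ, true_and] at hD
  obtain ⟨⟨hDc, hDi⟩, hDR⟩ := hD
  have hinj : ∀ D' : Finset X, #D' + 1 = Fintype.card I → D'.image c = univ.erase i₀ →
      Set.InjOn c D' := fun D' h1 h2 => card_image_iff.mp (by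
    rw [h2, card_erase_of_mem (mem_univ _), card_univ]; omega)
  obtain ⟨x, hx, rfl⟩ := exists_eq_insert_iff.mpr ⟨hDR, hDc.trans hR.symm⟩
  -- Otherwise `R` would show all colours. So `x` repeats the colour of some `y ∈ D`, and only
  -- deleting `x` or `y` from `R` leaves distinct colours.
  have hxi : c x ≠ i₀ := by
    intro h
    apply hc
    rw [image_insert, hDi, h, insert_erase (mem_univ _)]
  obtain ⟨y, hy, hyx⟩ := mem_image.mp (hDi ▸ mem_erase.mpr ⟨hxi, mem_univ _⟩ : c x ∈ D.image c)
  have hxy : x ≠ y := fun h => hx (h ▸ hy)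
  have h2 : ({D' : Finset X | (#D' + 1 = Fintype.card I ∧ D'.image c = univ.erase i₀) ∧
      D' ⊆ insert x D} : Finset (Finset X)) = {D, insert x (D.erase y)} := by
    ext D'
    simp only [mem_filter, mem_univ, true_and, mem_insert, mem_singleton]
    constructor
    · rintro ⟨⟨h1, h2⟩, h3⟩
      obtain ⟨z, hz, hzR⟩ := exists_eq_insert_iff.mpr ⟨h3, h1.trans hR.symm⟩
      have hD' : D' = (insert x D).erase z := by rw [← hzR, erase_insert hz]
      by_cases hzx : z = x
      · left; rw [hD', hzx, erase_insert hx]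
      by_cases hzy : z = y
      · right; rw [hD', hzy, erase_insert_of_ne hxy]
      have hx' : x ∈ D' := hD' ▸ mem_erase.mpr ⟨Ne.symm hzx, mem_insert_self _ _⟩
      have hy' : y ∈ D' := hD' ▸ mem_erase.mpr ⟨Ne.symm hzy, mem_insert_of_mem hy⟩
      exact absurd (hinj D' h1 h2 hx' hy' hyx.symm) hxy
    · rintro (rfl | rfl)
      · exact ⟨⟨hDc, hDi⟩, subset_insert _ _⟩
      · refine ⟨⟨?_, ?_⟩, insert_subset_insert _ (erase_subset _ _)⟩
        · rw [card_insert_of_notMem (fun h => hx (mem_of_mem_erase h)), card_erase_add_one hy, hDc]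
        · rw [image_insert, ← hyx, ← image_insert, insert_erase hy, hDi]
  rw [h2, card_pair]
  · exact even_two
  · intro h
    exact hx (h ▸ mem_insert_self _ _)

end Abstract

/-! ### Slack points and Scarf's lemma. -/

section Slack

variable {I T L : Type*} [LinearOrder L] [Fintype I] {r : I → T ⊕ I → L}

open Classical in
/-- The set of all slack points but one extends to exactly one dominant set with as many points as
there are indices. -/
theorem card_dominant_supersets_slack [Fintype T] [Nonempty T] (hr : ∀ i, Injective (r i))
    (hbot : ∀ i x, r i (.inr i) ≤ r i x)
    (htop : ∀ i j, j ≠ i → ∀ t, r i (.inl t) < r i (.inr j)) (i₀ : I) :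
    #{R : Finset (T ⊕ I) | (#R = Fintype.card I ∧ IsDominant r R) ∧
      (univ.erase i₀).map Embedding.inr ⊆ R} = 1 := by
  set D : Finset (T ⊕ I) := (univ.erase i₀).map Embedding.inr with hD
  have hmemD : ∀ l, l ≠ i₀ → (.inr l : T ⊕ I) ∈ D := fun l hl =>
    mem_map_of_mem Embedding.inr (mem_erase.mpr ⟨hl, mem_univ _⟩)
  have hinl : ∀ t, (.inl t : T ⊕ I) ∉ D := by simp [hD]
  have hcard : #D + 1 = Fintype.card I := by
    rw [hD, card_map, card_erase_add_one (mem_univ _), card_univ]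
  have hlt : ∀ l t, r l (.inr l) < r l (.inl t) := fun l t =>
    lt_of_le_of_ne (hbot l _) fun h => Sum.inr_ne_inl (hr l h)
  obtain ⟨t₀, ht₀⟩ := Finite.exists_max fun t => r i₀ (.inl t)
  rw [card_eq_one]
  refine ⟨insert (.inl t₀) D, ?_⟩
  ext R
  simp only [mem_filter, mem_univ, true_and, mem_singleton]
  constructor
  · rintro ⟨⟨hR, hdom⟩, hDR⟩
    obtain ⟨z, hz, rfl⟩ := exists_eq_insert_iff.mpr ⟨hDR, hcard.trans hR.symm⟩
    -- For `l ≠ i₀` the slack point `.inr l ∈ D` is strictly below `.inl t`, so dominance can only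
    -- be witnessed at `i₀`.
    have key : ∀ t, r i₀ (.inl t) ≤ r i₀ z := by
      intro t
      obtain ⟨l, hl⟩ := hdom (.inl t)
      by_cases hli : l = i₀
      · exact hli ▸ hl z (mem_insert_self _ _)
      · exact absurd (hl _ (mem_insert_of_mem (hmemD l hli))) (not_le.mpr (hlt l t))
    rcases z with t | l
    · have h1 := hr i₀ (le_antisymm (ht₀ t) (key t₀))
      rw [h1]
    · by_cases hli : l = i₀
      · exact absurd (hli ▸ key t₀) (not_le.mpr (hlt i₀ t₀))
      · exact absurd (hmemD l hli) hz
  · rintro rfl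
    refine ⟨⟨(card_insert_of_notMem (hinl t₀)).trans hcard, ?_⟩, subset_insert _ _⟩
    rintro (t | l)
    · refine ⟨i₀, fun z hz => ?_⟩
      rcases mem_insert.mp hz with rfl | hz
      · exact ht₀ t
      · obtain ⟨l, hl, rfl⟩ := mem_map.mp hz
        exact (htop i₀ l (mem_erase.mp hl).1 t).le
    · exact ⟨l, fun z _ => hbot l z⟩

open Classical in
/-- **Scarf's lemma**: there is a dominant set that contains each colour exactly once. -/
theorem exists_colourful_dominant [Fintype T] [Nonempty T] [Nonempty I]
    (hr : ∀ i, Injective (r i)) (hbot : ∀ i x, r i (.inr i) ≤ r i x)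
    (htop : ∀ i j, j ≠ i → ∀ t, r i (.inl t) < r i (.inr j)) (c : T → I) :
    ∃ R : Finset (T ⊕ I), #R = Fintype.card I ∧ IsDominant r R ∧
      R.image (Sum.elim c id) = univ := by
  by_contra hno
  push Not at hno
  obtain ⟨i₀⟩ := ‹Nonempty I›
  set γ : T ⊕ I → I := Sum.elim c id
  set rooms : Finset (Finset (T ⊕ I)) := {R | #R = Fintype.card I ∧ IsDominant r R} with hrooms
  set doors : Finset (Finset (T ⊕ I)) :=
    {D | #D + 1 = Fintype.card I ∧ D.image γ = univ.erase i₀} with hdoors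
  set D₀ : Finset (T ⊕ I) := (univ.erase i₀).map Embedding.inr with hD₀
  -- Without a colourful room every room has evenly many doors. But `D₀` lies in one room and every
  -- other door in none or two, so the total is odd.
  have hcount := sum_card_bipartiteAbove_eq_sum_card_bipartiteBelow
    (s := doors) (t := rooms) (fun D R => D ⊆ R)
  have hAbove : ∀ D, bipartiteAbove (fun D R => D ⊆ R) rooms D =
      ({R | (#R = Fintype.card I ∧ IsDominant r R) ∧ D ⊆ R} : Finset (Finset (T ⊕ I))) := by
    intro D; ext R; simp [bipartiteAbove, hrooms]
  have hBelow : ∀ R, bipartiteBelow (fun D R => D ⊆ R) doors R =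
      ({D | (#D + 1 = Fintype.card I ∧ D.image γ = univ.erase i₀) ∧ D ⊆ R} :
        Finset (Finset (T ⊕ I))) := by
    intro R; ext D; simp [bipartiteBelow, hdoors]
  have hEven : Even (∑ R ∈ rooms, #(bipartiteBelow (fun D R => D ⊆ R) doors R)) := by
    refine even_sum _ fun R hR => ?_
    obtain ⟨h1, h2⟩ := (mem_filter.mp hR).2
    rw [hBelow, Nat.even_iff]
    convert Nat.even_iff.mp (even_card_subsets_of_not_colourful γ i₀ h1 (hno R h1 h2))
  have hD₀mem : D₀ ∈ doors := by
    refine mem_filter.mpr ⟨mem_univ _, ?_, ?_⟩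
    · rw [hD₀, card_map, card_erase_add_one (mem_univ _), card_univ]
    · ext l; simp [hD₀, γ]
  rw [← hcount, ← add_sum_erase _ _ hD₀mem] at hEven
  have h1 : #(bipartiteAbove (fun D R => D ⊆ R) rooms D₀) = 1 := by
    rw [hAbove]
    convert card_dominant_supersets_slack hr hbot htop i₀
  rw [h1] at hEven
  have hEven' : Even (∑ D ∈ doors.erase D₀, #(bipartiteAbove (fun D R => D ⊆ R) rooms D)) := by
    refine even_sum _ fun D hD => ?_
    obtain ⟨hne, hDd⟩ := mem_erase.mp hD
    obtain ⟨hc, hi⟩ := (mem_filter.mp hDd).2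
    by_cases hdom : IsDominant r D
    swap
    · have : bipartiteAbove (fun D R => D ⊆ R) rooms D = ∅ := by
        refine eq_empty_of_forall_notMem fun R hR => hdom ?_
        obtain ⟨hR1, hR2⟩ := mem_filter.mp hR
        exact ((mem_filter.mp hR1).2.2).mono hR2
      rw [this]; simp
    -- A slack point is coloured by its own index, so the only door made of slack points alone is
    -- `D₀`.
    obtain ⟨t, ht⟩ : ∃ t, (.inl t : T ⊕ I) ∈ D := by
      by_contra hnot
      push Not at hnot
      apply hne
      ext x
      rcases x with t | l
      · simp [hnot t, hD₀]
      · have : l ∈ D.image γ ↔ (.inr l : T ⊕ I) ∈ D := by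
          constructor
          · intro h
            obtain ⟨z, hz, rfl⟩ := mem_image.mp h
            rcases z with t | l
            · exact absurd hz (hnot t)
            · exact hz
          · exact fun h => mem_image.mpr ⟨_, h, rfl⟩
        rw [← this, hi]
        simp [hD₀]
    choose m hmD hmin using fun l => exists_min_image D (r l) ⟨_, ht⟩
    have := card_dominant_supersets hr hdom hc hmD hmin fun i => ⟨.inr i, fun l hl => by
      rcases hml : m l with t' | j
      · exact htop l i hl.symm t'
      · by_cases hjl : j = l
        · subst hjl
          exact lt_of_le_of_ne (hbot j _) fun h => hl (Sum.inr_injective (hr j h))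
        · exact absurd (hml ▸ hmin l _ ht) (not_le.mpr (htop l j hjl t))⟩
    rw [hAbove, Nat.even_iff]
    convert Nat.mod_self 2
    convert this
  have := (Nat.even_add.mp hEven).mpr hEven'
  exact absurd this (by decide)

end Slack

/-! ### Scarf's lemma on the grid of the simplex. -/

/-- The points of the grid of mesh `1 / N` in the simplex, scaled by `N`. -/
abbrev GridPoint (I : Type*) [Fintype I] (N : ℕ) : Type _ := {x : I → ℕ // ∑ i, x i = N}

/-- In a coloured grid of points with sum `N` there is a small cube which, for every `i`, contains a
grid point of colour `i` or touches the `i`-th face. -/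
theorem exists_small_cube {I : Type*} [Fintype I] [Nonempty I] (N : ℕ)
    (c : GridPoint I N → I) :
    ∃ m : I → ℤ, ∃ x₀ : GridPoint I N,
      (∀ l, m l ≤ x₀.1 l ∧ (x₀.1 l : ℤ) ≤ m l + Fintype.card I) ∧
      ∀ i, m i ≤ 0 ∨ ∃ x, c x = i ∧ ∀ l, m l ≤ x.1 l ∧ (x.1 l : ℤ) ≤ m l + Fintype.card I := by
  classical
  have hle : ∀ (x : GridPoint I N) (i : I), x.1 i ≤ N := fun x i => by
    conv_rhs => rw [← x.2]
    exact single_le_sum (fun _ _ => Nat.zero_le _) (mem_univ i)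
  have hfin : Finite (GridPoint I N) := Finite.of_injective
    (fun (x : GridPoint I N) (i : I) => (⟨x.1 i, Nat.lt_succ_of_le (hle x i)⟩ : Fin (N + 1))) fun x y h =>
      Subtype.ext (funext fun i => congrArg Fin.val (congrFun h i))
  have := Fintype.ofFinite (GridPoint I N)
  obtain ⟨j₀⟩ := ‹Nonempty I›
  have hadd : ∀ b : I → ℕ, ∑ i, b i ≤ N → ∃ y : GridPoint I N, ∀ i, b i ≤ y.1 i := by
    intro b hb
    refine ⟨⟨b + Pi.single j₀ (N - ∑ i, b i), ?_⟩, fun i => ?_⟩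
    · simp only [Pi.add_apply, sum_add_distrib, sum_pi_single', mem_univ, if_true]
      omega
    · simp
  have hT : Nonempty (GridPoint I N) := (hadd 0 (by simp)).nonempty
  -- Grid coordinates lie in `0, …, N`, so `-1` and `N + 1` place the slack points below and above
  -- all of them. The enumeration `e` breaks ties in `r`.
  set g : I → GridPoint I N ⊕ I → ℤ := fun i => Sum.elim (fun t => (t.1 i : ℤ))
    fun j => if j = i then -1 else N + 1 with hg
  let e := Fintype.equivFin (GridPoint I N ⊕ I)
  let r : I → GridPoint I N ⊕ I → ℤ ×ₗ Fin (Fintype.card (GridPoint I N ⊕ I)) := fun i x => toLex (g i x, e x)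
  have hr : ∀ i, Injective (r i) := fun i x y h =>
    e.injective (congrArg (fun z => (ofLex z).2) h)
  have hg1 : ∀ r₁ : I, ∀ x, -1 ≤ g r₁ x := by
    rintro i (t | j)
    · simp only [hg, Sum.elim_inl]; omega
    · simp only [hg, Sum.elim_inr]; split_ifs <;> omega
  have hgle : ∀ i x y, r i x ≤ r i y → g i x ≤ g i y := fun i x y h => by
    rcases Prod.Lex.toLex_le_toLex.mp h with h | h
    · exact h.le
    · exact h.1.le
  have hbot : ∀ i x, r i (.inr i) ≤ r i x := by
    intro i x
    by_cases hx : x = .inr i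
    · rw [hx]
    · refine Prod.Lex.toLex_le_toLex.mpr (Or.inl ?_)
      rcases x with t | j
      · simp only [hg, Sum.elim_inl, Sum.elim_inr, if_true]; omega
      · have : j ≠ i := fun h => hx (h ▸ rfl)
        simp only [hg, Sum.elim_inr, if_true, if_neg this]; omega
  have htop : ∀ i j, j ≠ i → ∀ t, r i (.inl t) < r i (.inr j) := by
    intro i j hj t
    refine Prod.Lex.toLex_lt_toLex.mpr (Or.inl ?_)
    have := hle t i
    simp only [hg, Sum.elim_inl, Sum.elim_inr, if_neg hj]; omega
  have : Nonempty I := ⟨j₀⟩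
  obtain ⟨R, hRc, hdom, hcol⟩ := exists_colourful_dominant hr hbot htop c
  have hRne : R.Nonempty := card_pos.mp (hRc ▸ Fintype.card_pos)
  choose a haR ha using fun i => exists_min_image R (g i) hRne
  -- Otherwise some grid point exceeds every coordinate minimum of `R`, against dominance. This
  -- bound makes the excesses of a grid point of `R` over the minima sum to less than `card I`.
  have hbig : (N : ℤ) < ∑ i, (g i (a i) + 1) := by
    by_contra hlt
    push Not at hlt
    obtain ⟨y, hy⟩ := hadd (fun i => (g i (a i) + 1).toNat) (by
      zify
      refine le_trans (le_of_eq (sum_congr rfl fun i _ => ?_)) hlt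
      have := hg1 i (a i)
      omega)
    obtain ⟨i, hi⟩ := hdom (.inl y)
    have h1 := hgle _ _ _ (hi _ (haR i))
    have h2 := hy i
    have h3 : g i (.inl y) = y.1 i := rfl
    omega
  have hclose : ∀ x : GridPoint I N, .inl x ∈ R →
      ∀ l, g l (a l) ≤ x.1 l ∧ (x.1 l : ℤ) ≤ g l (a l) + Fintype.card I := by
    intro x hx l
    have h0 : ∀ i, g i (a i) ≤ x.1 i := fun i => ha i _ hx
    refine ⟨h0 l, ?_⟩
    have h1 : (x.1 l : ℤ) - g l (a l) ≤ ∑ i, ((x.1 i : ℤ) - g i (a i)) :=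
      single_le_sum (f := fun i => (x.1 i : ℤ) - g i (a i))
        (fun i _ => sub_nonneg.mpr (h0 i)) (mem_univ l)
    have h2 : ∑ i, (x.1 i : ℤ) = N := by exact_mod_cast x.2
    rw [sum_sub_distrib, h2] at h1
    rw [sum_add_distrib] at hbig
    simp only [sum_const, card_univ, nsmul_eq_mul, mul_one] at hbig
    omega
  have hrep : ∀ i, .inr i ∈ R ∨ ∃ x : GridPoint I N, .inl x ∈ R ∧ c x = i := by
    intro i
    obtain ⟨z, hz, hzi⟩ := mem_image.mp (hcol ▸ mem_univ i : i ∈ R.image (Sum.elim c id))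
    rcases z with x | j
    · exact Or.inr ⟨x, hz, hzi⟩
    · exact Or.inl ((show j = i from hzi) ▸ hz)
  -- If the witnessing index were represented by its own slack point, a grid coordinate would be at
  -- most `-1`.
  obtain ⟨x₀, hx₀⟩ : ∃ x : GridPoint I N, .inl x ∈ R := by
    obtain ⟨y⟩ := hT
    obtain ⟨i, hi⟩ := hdom (.inl y)
    rcases hrep i with h | ⟨x, hx, -⟩
    · have h1 := hgle _ _ _ (hi _ h)
      simp only [hg, Sum.elim_inl, Sum.elim_inr, if_true] at h1
      omega
    · exact ⟨x, hx⟩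
  refine ⟨fun i => g i (a i), x₀, hclose x₀ hx₀, fun i => ?_⟩
  rcases hrep i with h | ⟨x, hx, hxi⟩
  · left
    have h1 := ha i _ h
    simp only [hg, Sum.elim_inr, if_true] at h1 ⊢
    omega
  · exact Or.inr ⟨x, hxi, hclose x hx⟩

end Scarf

/-! ### Brouwer's theorem from approximate inequalities. -/

/-- Every self-map of the standard simplex has, at every scale, a small cluster of points that
witnesses `z i ≤ f z i` up to a small error for every coordinate. -/
theorem stdSimplex.exists_approx_le {I : Type*} [Fintype I] [Nonempty I]
    (f : stdSimplex ℝ I → stdSimplex ℝ I) (n : ℕ) :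
    ∃ x : stdSimplex ℝ I, ∀ i, ∃ z : stdSimplex ℝ I,
      dist z x ≤ Fintype.card I * (1 / ((n : ℝ) + 1)) ∧
        z.1 i - Fintype.card I * (1 / ((n : ℝ) + 1)) ≤ (f z).1 i := by
  set N : ℕ := n + 1
  have hN : (0 : ℝ) < N := by positivity
  have hN' : (n : ℝ) + 1 = N := by push_cast [N]; rfl
  rw [hN']
  let s : Scarf.GridPoint I N → stdSimplex ℝ I := fun x =>
    ⟨fun i => (x.1 i : ℝ) / N, fun i => by positivity, by
      rw [← Finset.sum_div, div_eq_one_iff_eq hN.ne']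
      exact_mod_cast x.2⟩
  -- The coordinates of `z` and of `f z` both sum to `1`, so they cannot all decrease.
  have hcol : ∀ z : stdSimplex ℝ I, ∃ i, z.1 i ≤ (f z).1 i := by
    intro z
    by_contra! h
    have := Finset.sum_lt_sum_of_nonempty Finset.univ_nonempty fun i _ => h i
    rw [z.2.2, (f z).2.2] at this
    exact lt_irrefl _ this
  choose c hc using hcol
  obtain ⟨m, x₀, hx₀, h⟩ := Scarf.exists_small_cube N (c ∘ s)
  have hdist : ∀ x y : Scarf.GridPoint I N,
      (∀ l, m l ≤ x.1 l ∧ (x.1 l : ℤ) ≤ m l + Fintype.card I) →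
      (∀ l, m l ≤ y.1 l ∧ (y.1 l : ℤ) ≤ m l + Fintype.card I) →
      dist (s x) (s y) ≤ Fintype.card I * (1 / (N : ℝ)) := by
    intro x y hx hy
    rw [Subtype.dist_eq, dist_pi_le_iff (by positivity)]
    intro l
    have h1 : |(x.1 l : ℤ) - y.1 l| ≤ Fintype.card I := by
      have := hx l; have := hy l
      rw [abs_le]; omega
    have h2 : |(x.1 l : ℝ) - y.1 l| ≤ Fintype.card I := by exact_mod_cast h1
    change |(x.1 l : ℝ) / N - (y.1 l : ℝ) / N| ≤ _
    rw [← sub_div, abs_div, abs_of_pos hN, mul_one_div]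
    gcongr
  refine ⟨s x₀, fun i => ?_⟩
  rcases h i with hi | ⟨x, rfl, hx⟩
  -- Near the `i`-th face the coordinate itself is within the error, and `f` has nonnegative
  -- coordinates.
  · refine ⟨s x₀, by rw [dist_self]; positivity, ?_⟩
    have h1 : (x₀.1 i : ℤ) ≤ Fintype.card I := by have := (hx₀ i).2; omega
    have h2 : (x₀.1 i : ℝ) ≤ Fintype.card I := by exact_mod_cast h1
    have h3 : (s x₀).1 i ≤ Fintype.card I * (1 / (N : ℝ)) := by
      change (x₀.1 i : ℝ) / N ≤ _
      rw [mul_one_div]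
      gcongr
    linarith [(f (s x₀)).2.1 i]
  · refine ⟨s x, hdist x x₀ hx hx₀, ?_⟩
    have := hc (s x)
    have h2 : (0 : ℝ) ≤ Fintype.card I * (1 / (N : ℝ)) := by positivity
    simp only [Function.comp]
    linarith

/-- **Brouwer's fixed point theorem** for the standard simplex. -/
theorem stdSimplex.exists_isFixedPt {I : Type*} [Fintype I] [Nonempty I]
    (f : stdSimplex ℝ I → stdSimplex ℝ I) (hf : Continuous f) : ∃ x, Function.IsFixedPt f x := by
  choose x z hz hzf using stdSimplex.exists_approx_le f
  obtain ⟨p, φ, hφ, hp⟩ := CompactSpace.tendsto_subseq x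
  have hε : Tendsto (fun n : ℕ => (Fintype.card I : ℝ) * (1 / ((n : ℝ) + 1))) atTop (𝓝 0) := by
    simpa using tendsto_one_div_add_atTop_nhds_zero_nat.const_mul (Fintype.card I : ℝ)
  have hle : ∀ i, p.1 i ≤ (f p).1 i := by
    intro i
    have hzp : Tendsto (fun n => z (φ n) i) atTop (𝓝 p) := by
      refine tendsto_of_tendsto_of_dist hp (squeeze_zero (fun _ => dist_nonneg) (fun n => ?_)
        (hε.comp hφ.tendsto_atTop))
      rw [dist_comm]
      exact hz (φ n) i
    have hev : Continuous fun q : stdSimplex ℝ I => q.1 i :=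
      (continuous_apply i).comp continuous_subtype_val
    have h1 := ((hev.tendsto p).comp hzp).sub (hε.comp hφ.tendsto_atTop)
    have h2 := ((hev.comp hf).tendsto p).comp hzp
    rw [sub_zero] at h1
    exact le_of_tendsto_of_tendsto' h1 h2 fun n => hzf (φ n) i
  refine ⟨p, Subtype.ext (funext fun i => ?_)⟩
  have hsum : ∑ i, p.1 i = ∑ i, (f p).1 i := p.2.2.trans (f p).2.2.symm
  exact ((Finset.sum_eq_sum_iff_of_le fun i _ => hle i).mp hsum i (Finset.mem_univ i)).symm

/-! ### Nash's map and existence of equilibrium. -/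

/-- A continuous payoff vector field on the standard simplex has a symmetric equilibrium: some point
`p` at which every coordinate of the payoff is at most the average payoff under `p`. -/
theorem stdSimplex.exists_le_average {I : Type*} [Fintype I] [Nonempty I]
    (u : stdSimplex ℝ I → I → ℝ) (hu : Continuous u) :
    ∃ p : stdSimplex ℝ I, ∀ i, u p i ≤ ∑ j, u p j * p.1 j := by
  let g : I → stdSimplex ℝ I → ℝ := fun i p => max 0 (u p i - ∑ j, u p j * p.1 j)
  have hui : ∀ i, Continuous fun p => u p i := fun i => (continuous_apply i).comp hu
  have hpi : ∀ i, Continuous fun p : stdSimplex ℝ I => p.1 i := fun i =>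
    (continuous_apply i).comp continuous_subtype_val
  have hg : ∀ i, Continuous (g i) := fun i => continuous_const.max
    ((hui i).sub (continuous_finsetSum _ fun j _ => (hui j).mul (hpi j)))
  have hg0 : ∀ i p, 0 ≤ g i p := fun i p => le_max_left _ _
  have hG : ∀ p, 0 < 1 + ∑ j, g j p := fun p => by
    have := Finset.sum_nonneg fun j (_ : j ∈ Finset.univ) => hg0 j p
    linarith
  let F : stdSimplex ℝ I → stdSimplex ℝ I := fun p =>
    ⟨fun i => (p.1 i + g i p) / (1 + ∑ j, g j p),
      fun i => div_nonneg (add_nonneg (p.2.1 i) (hg0 i p)) (hG p).le, by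
        rw [← Finset.sum_div, Finset.sum_add_distrib, p.2.2, div_self (hG p).ne']⟩
  have hF : Continuous F := Continuous.subtype_mk (continuous_pi fun i =>
    ((hpi i).add (hg i)).div (continuous_const.add (continuous_finsetSum _ fun j _ => hg j))
      fun p => (hG p).ne') _
  obtain ⟨p, hp⟩ := stdSimplex.exists_isFixedPt F hF
  have hfix : ∀ i, g i p = p.1 i * ∑ j, g j p := by
    intro i
    have h1 : (p.1 i + g i p) / (1 + ∑ j, g j p) = p.1 i := congrFun (congrArg Subtype.val hp) i
    rw [div_eq_iff (hG p).ne'] at h1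
    linarith
  set S := ∑ j, g j p with hS
  set a := ∑ j, u p j * p.1 j with ha
  have hS0 : S = 0 := by
    by_contra hne
    have hpos : 0 < S := lt_of_le_of_ne (Finset.sum_nonneg fun j _ => hg0 j p) (Ne.symm hne)
    have hterm : ∀ i, g i p * g i p = (u p i - a) * g i p := by
      intro i
      rcases le_total 0 (u p i - a) with h | h
      · have : g i p = u p i - a := max_eq_right h
        rw [this]
      · have : g i p = 0 := max_eq_left h
        rw [this]; ring
    -- Since `g i p = p i * S`, the sum is `S` times the `p`-average of `u p i - a`, which is zero
    -- as `a` is the average.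
    have hsum : ∑ i, g i p * g i p = 0 := by
      calc ∑ i, g i p * g i p = ∑ i, (u p i * p.1 i - a * p.1 i) * S :=
            Finset.sum_congr rfl fun i _ => by rw [hterm i, hfix i]; ring
        _ = 0 := by
            rw [← Finset.sum_mul, Finset.sum_sub_distrib, ← Finset.mul_sum, p.2.2, ← ha]; ring
    have hz := (Finset.sum_eq_zero_iff_of_nonneg fun i _ => mul_self_nonneg _).mp hsum
    exact hne (Finset.sum_eq_zero fun i hi => mul_self_eq_zero.mp (hz i hi))
  refine ⟨p, fun i => ?_⟩
  have h1 : g i p = 0 := by rw [hfix i, hS0, mul_zero]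
  have h2 : u p i - a ≤ g i p := le_max_right _ _
  linarith

/-! ### Equilibria as fixed points of the projection. -/

/-- A point `p` of a set `S` that maximizes `⟪w, ·⟫` over `S` is a nearest point of `S` to
`p + w`. -/
theorem QueueingGame.mem_projSet_add {E : Type*} [NormedAddCommGroup E] [InnerProductSpace ℝ E]
    {S : Set E} {p w : E} (hp : p ∈ S) (h : ∀ z ∈ S, inner ℝ w z ≤ inner ℝ w p) :
    p ∈ projSet S (p + w) := by
  refine ⟨hp, fun z hz => ?_⟩
  rw [add_sub_cancel_left]
  refine le_of_sq_le_sq ?_ (norm_nonneg _)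
  have e : p + w - z = w + (p - z) := by abel
  rw [e, norm_add_sq_real, inner_sub_right]
  nlinarith [h z hz, sq_nonneg ‖p - z‖]

theorem mainTheorem6 {k d : ℕ} {Ω : Type*} [MeasurableSpace Ω] {𝒴 : Type*} [MeasurableSpace 𝒴]
    (G : QueueingGame.UnobservableQueueingGame k d Ω 𝒴) (hu : Continuous G.u) :
    (∃ p : QueueingGame.Strategy k, G.IsSymmetricNashEquilibrium p) ∧
      ∀ p : QueueingGame.Strategy k, G.IsSymmetricNashEquilibrium p → p = G.f p := by
  have hk : 0 < k := lt_of_lt_of_le Nat.zero_lt_two G.two_le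
  constructor
  · have : Nonempty (Fin k) := ⟨⟨0, hk⟩⟩
    let toStrategy : stdSimplex ℝ (Fin k) → QueueingGame.Strategy k := fun q =>
      ⟨WithLp.toLp 2 q.1, q.2⟩
    have hcont : Continuous toStrategy :=
      ((PiLp.continuous_toLp 2 _).comp continuous_subtype_val).subtype_mk _
    obtain ⟨p, hp⟩ := stdSimplex.exists_le_average (fun q i => G.u (toStrategy q) i)
      ((PiLp.continuous_ofLp 2 _).comp (hu.comp hcont))
    refine ⟨toStrategy p, fun r => ?_⟩
    calc ∑ i, G.u (toStrategy p) i * r.1 i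
        ≤ ∑ i, (∑ j, G.u (toStrategy p) j * p.1 j) * r.1 i :=
          Finset.sum_le_sum fun i _ => mul_le_mul_of_nonneg_right (hp i) (r.2.1 i)
      _ = ∑ j, G.u (toStrategy p) j * p.1 j := by
          have hr : ∑ i, r.1 i = 1 := r.2.2
          rw [← Finset.mul_sum, hr, mul_one]
  · intro p hp
    have hmem := QueueingGame.mem_projSet_add (w := G.u p) p.2 fun z hz => by
      simpa only [PiLp.inner_apply, RCLike.inner_apply, conj_trivial, mul_comm] using hp ⟨z, hz⟩
    rw [QueueingGame.projSet_simplex_eq hk] at hmem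
    exact Subtype.ext hmem
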